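/- **Notation.** Let $t$ be an integer. *Graphs.* For a map $f:S\to S$ of a finite set, $\mathcal G(f/S)$ is the directed graph with vertex set $S$ and edges $s\to f(s)$. $\bigoplus$ denotes the disjoint union of directed graphs, and $n\times H$ is the disjoint union of $n$ copies of $H$. Rooted trees are directed towards the root; $\bullet$ is the one-vertex tree, and for rooted trees $T_1,\dots,T_m$, $\langle T_1\oplus\cdots\oplus T_m\rangle$ is the rooted tree whose root has exactly $m$ children, which are the roots of copies of $T_1,\dots,T_m$ (with $\langle\emptyset\rangle=\bullet$). For $m\ge 1$, $\operatorname{Cyc}(m,T)$ is the directed graph consisting of a directed $m$-cycle (a loop if $m=1$) each of whose vertices is the root of a copy of the rooted tree $T$. *Elementary trees.* For a non-increasing sequence of positive integers $v=(v_1,\dots,v_D)$ with $D \geq 1$ put $T_v^0=\bullet$, $$T_v^{k}=\Big\langle v_k\times T_v^{k-1}\oplus\bigoplus_{i=1}^{k-1}(v_i-v_{i+1})\times T_v^{i-1}\Big\rangle\quad(1\le k<D),\qquad T_v=\Big\langle (v_D-1)\times T_v^{D-1}\oplus\bigoplus_{i=1}^{D-1}(v_i-v_{i+1})\times T_v^{i-1}\Big\rangle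 .$$ *Iterated gcd.* For $n\ge1$, $\gcd_t(n)=(1)$ if $\gcd(t,n)=1$; otherwise $\gcd_t(n)=(n_1,\dots,n_D)$, where $n_1=\gcd(t,n)$, $n_{i+1}=\gcd\big(t,\,n/(n_1\cdots n_i)\big)$ for $i\ge 1$, and $D$ is the least positive integer with $n_{D+1}=1$. The product of finitely many finite sequences is the coordinatewise product, the shorter sequences being extended by terms equal to $1$ (the empty product is the sequence $(1)$). **Proposition.** Let $G$ be a finite abelian group, written as $G\cong\mathcal C_{r_1}\times\cdots\times\mathcal C_{r_k}$ with $\mathcal C_{r_i}$ cyclic of order $r_i\ge 1$, and let $\varphi_t:G\to G$, $\varphi_t(g)=g^t$. For each $i$ let $\omega_i$ be the greatest divisor of $r_i$ that is relatively prime to $t$, and write $r_i=\nu_i\omega_i$. Put $\gcd_t(\nu)=\prod_{i=1}^k\gcd_t(\nu_i)$. For $d=(d_1,\dots,d_k)$ with $d_i\mid\omega_i$ for all $i$ (written $d\mid\omega$) put $\varphi(d)=\prod_{i=1}^k\varphi(d_i)$, with $\varphi$ Euler's function, and $\operatorname{ord}_d(t)=\operatorname{lcm}\{\operatorname{ord}_{d_i}(t):1\le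 i\le k\}$, where $\operatorname{ord}_{d_i}(t)$ is the multiplicative order of $t$ modulo $d_i$. Then $G$ has exactly $\prod_{i=1}^k\omega_i$ elements that are $\varphi_t$-periodic, each $\varphi(d)/\operatorname{ord}_d(t)$ with $d\mid\omega$ is an integer, and there is an isomorphism of directed graphs $$\mathcal G(\varphi_t/G)\;\cong\;\bigoplus_{d\mid\omega}\frac{\varphi(d)}{\operatorname{ord}_d(t)}\times\operatorname{Cyc}\big(\operatorname{ord}_d(t),\,T_{\gcd_t(\nu)}\big).$$ -/

import Mathlib

namespace PowerMap

/-- The functional graph of `f : S → S`: the edges are `s ⟶ f s`. -/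
def functionalGraph {S : Type*} (f : S → S) : Digraph S where
  Adj a b := f a = b

/-- Isomorphism of directed graphs. -/
def DigraphIso {V W : Type*} (G : Digraph V) (H : Digraph W) : Prop :=
  Nonempty (G.Adj ≃r H.Adj)

/-- The disjoint union `⨁ i, G i` of a family of directed graphs. -/
def disjointUnion {ι : Type*} {V : ι → Type*} (G : ∀ i, Digraph (V i)) :
    Digraph (Σ i, V i) where
  Adj a b := ∃ (i : ι) (v w : V i), a = ⟨i, v⟩ ∧ b = ⟨i, w⟩ ∧ (G i).Adj v w

/-- `n × G`: the disjoint union of `n` copies of `G`. -/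
def copies {V : Type*} (n : ℕ) (G : Digraph V) : Digraph (Σ _ : Fin n, V) :=
  disjointUnion fun _ => G

/-- A rooted tree, given by its parent map; by convention the root is its own parent
(this is not an edge of the tree, see `RootedTree.digraph`). -/
structure RootedTree where
  V : Type
  root : V
  parent : V → V
  parent_root : parent root = root
  exists_iterate_parent : ∀ v, ∃ n : ℕ, parent^[n] v = root

namespace RootedTree

/-- The directed graph of a rooted tree: the edges go from each non-root vertex to its parent. -/
def digraph (T : RootedTree) : Digraph T.V where
  Adj v w := v ≠ T.root ∧ T.parent v = w

/-- The one-vertex tree `•`. -/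
def single : RootedTree where
  V := Unit
  root := ()
  parent := id
  parent_root := rfl
  exists_iterate_parent := fun _ => ⟨0, rfl⟩

open Classical in
/-- The parent map of `⟨⨁ i, T i⟩`; the new root is `none`. -/
noncomputable def joinParent {ι : Type} (T : ι → RootedTree) :
    Option (Σ i, (T i).V) → Option (Σ i, (T i).V)
  | none => none
  | some ⟨i, v⟩ => if v = (T i).root then none else some ⟨i, (T i).parent v⟩

/-- `⟨⨁ i, T i⟩`: a new root whose children are the roots of the trees `T i`. -/
noncomputable def join {ι : Type} (T : ι → RootedTree) : RootedTree where
  V := Option (Σ i, (T i).V)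
  root := none
  parent := joinParent T
  parent_root := rfl
  exists_iterate_parent := by
    rintro (_ | ⟨i, v⟩)
    · exact ⟨0, rfl⟩
    · obtain ⟨n, hn⟩ := (T i).exists_iterate_parent v
      induction n generalizing v with
      | zero =>
        refine ⟨1, ?_⟩
        have hv : v = (T i).root := hn
        simp [joinParent, hv]
      | succ n ih =>
        by_cases hv : v = (T i).root
        · exact ⟨1, by simp [joinParent, hv]⟩
        · obtain ⟨m, hm⟩ := ih ((T i).parent v) hn
          refine ⟨m + 1, ?_⟩
          rw [Function.iterate_succ_apply]
          simpa [joinParent, hv] using hm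

end RootedTree

/-- `Cyc(m, T)` (for `m ≥ 1`): an `m`-cycle each of whose vertices `(i, root)` is the root of a
copy of `T`. -/
def Cyc (m : ℕ) (T : RootedTree) : Digraph (ZMod m × T.V) where
  Adj a b := (a.1 = b.1 ∧ T.digraph.Adj a.2 b.2) ∨
    (a.2 = T.root ∧ b.2 = T.root ∧ b.1 = a.1 + 1)

/-- The trees `T_v^k`. Here `v i` is the `(i+1)`-st term of the sequence, so that
`T_v^0 = •` and `T_v^(k+1) = ⟨v k × T_v^k ⊕ ⨁_{j < k} (v j - v (j+1)) × T_v^j⟩`. -/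
noncomputable def levelTree (v : ℕ → ℕ) : ℕ → RootedTree
  | 0 => RootedTree.single
  | k + 1 => RootedTree.join (ι := Fin (v k) ⊕ (Σ j : Fin k, Fin (v j - v (j + 1))))
      (Sum.elim (fun _ => levelTree v k) (fun p => levelTree v p.1))
termination_by k => k
decreasing_by
  · exact Nat.lt_succ_self k
  · exact Nat.lt_succ_of_lt p.1.isLt

/-- The elementary tree `T_v` of a non-increasing sequence of positive integers
`v = (v_1, …, v_d)`, where `T_v = ⟨(v_d - 1) × T_v^(d-1) ⊕ ⨁_{i < d} (v_i - v_{i+1}) × T_v^(i-1)⟩`.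
The empty sequence is treated as the sequence `(1)`: its tree is `•`. -/
noncomputable def elementaryTree (v : List ℕ) : RootedTree :=
  let s : ℕ → ℕ := fun i => v.getD i 1
  match v.length with
  | 0 => RootedTree.single
  | e + 1 => RootedTree.join (ι := Fin (s e - 1) ⊕ (Σ j : Fin e, Fin (s j - s (j + 1))))
      (Sum.elim (fun _ => levelTree s e) (fun p => levelTree s p.1))

/-- The terms of the iterated gcd: `iterGcdTerm t n i` is the `(i+1)`-st term,
`gcd (t, n / (product of the preceding terms))`. -/
def iterGcdTerm (t : ℤ) (n : ℕ) : ℕ → ℕ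
  | i => Int.gcd t ((n / ∏ j : Fin i, iterGcdTerm t n j.1 : ℕ) : ℤ)
termination_by i => i
decreasing_by exact j.isLt

open Classical in
/-- The iterated gcd `gcd_t(n) = (ν_1, …, ν_D)` of `n ≥ 1` relative to `t`: it is `(1)` if
`gcd(t, n) = 1`; otherwise `D` is the least positive integer such that `ν_{D+1} = 1`. -/
noncomputable def iterGcd (t : ℤ) (n : ℕ) : List ℕ :=
  if Int.gcd t n = 1 then [1]
  else (List.range (sInf {D : ℕ | 0 < D ∧ iterGcdTerm t n D = 1})).map (iterGcdTerm t n)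

/-- The coordinatewise product of finitely many sequences, the shorter ones being extended
by terms equal to `1`. -/
def seqProd {k : ℕ} (u : Fin k → List ℕ) : List ℕ :=
  (List.range (Finset.univ.sup fun j => (u j).length)).map fun i => ∏ j, (u j).getD i 1

/-- `φ(d) = ∏ φ(d_i)`. -/
def totientProd {k : ℕ} (d : Fin k → ℕ) : ℕ := ∏ i, Nat.totient (d i)

/-- `ord_d(t) = lcm (ord_{d_i}(t))`, where `ord_n(t)` is the multiplicative order of `t` mod `n`. -/
noncomputable def ordLcm {k : ℕ} (d : Fin k → ℕ) (t : ℤ) : ℕ :=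
  Finset.univ.lcm fun i => orderOf ((t : ℤ) : ZMod (d i))

end PowerMap

namespace PowerMap

/-! By the Chinese remainder theorem, `g ↦ g ^ t` becomes multiplication by `t` on `N × P`, where `N
= ∏ ZMod (ν i)` and `P = ∏ ZMod (ω i)`. It is nilpotent on `N`, because every prime factor of `ν i`
divides `t`, and bijective on `P`.

On `P`, the period of a point depends only on the tuple `d` of additive orders of its coordinates:
it is `ordLcm d t`, and `totientProd d` points have these orders. This yields the cycles
(`exists_equiv_pi_zmod_cycles`).

On `N`, let the height of `y` be the `j` with `y ∈ range f^[j]` and `y ∉ range f^[j + 1]`. The fibre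
over a point of `range f^[j + 1]` meets `range f^[j]` in a coset of `ker f ∩ range f^[j]`, so kernel
sizes count the children of each height, and the tree above a nonzero point depends only on its
height (`hangsFrom_levelTree`). At `0` one preimage is `0` itself, whence the `- 1` in
`elementaryTree`. For a cyclic group the kernel sizes are the iterated gcd terms
(`card_range_zsmul_mul_prod`), and they multiply over direct factors.

Finally, a nilpotent map times a permutation is conjugate to the permutation with the tree hung on
every point (`HangsFrom.exists_equiv_prod`). -/

open Function Set

/-! ### Trees of iterated preimages -/

/-- `T` is isomorphic to the tree of iterated preimages of `x` under `f`. -/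
def HangsFrom {S : Type*} (f : S → S) (x : S) (T : RootedTree) : Prop :=
  ∃ φ : T.V → S, Injective φ ∧ φ T.root = x ∧
    (∀ v, v ≠ T.root → f (φ v) = φ (T.parent v)) ∧ range φ = {y | ∃ n, f^[n] y = x}

/-- If `n < m`, the orbit of `y` runs through `a`, then `x`, then `b`, and back to `x`; so `x` is
periodic, hence fixed, forcing `b = x`. This makes the subtrees above distinct children disjoint. -/
theorem not_lt_of_iterate_eq_children {S : Type*} {f : S → S}
    (hf : ∀ x n, f^[n + 1] x = x → f x = x) {x y a b : S} (ha : f a = x)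
    (hb : f b = x) (hbx : b ≠ x) {n m : ℕ} (hn : f^[n] y = a) (hm : f^[m] y = b) : ¬ n < m := by
  intro h
  obtain ⟨l, rfl⟩ := Nat.exists_eq_add_of_lt h
  have h1 : f^[l] x = b := by
    rw [← ha, ← hn, ← iterate_succ_apply, ← iterate_add_apply, ← hm,
      show l.succ + n = n + l + 1 by omega]
  have h2 : f^[l + 1] x = x := by rw [iterate_succ_apply', h1, hb]
  exact hbx (h1 ▸ iterate_fixed (hf x l h2) l)

theorem HangsFrom.join {S : Type*} {f : S → S} (hf : ∀ x n, f^[n + 1] x = x → f x = x)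
    {x : S} {ι : Type} {T : ι → RootedTree} {c : ι → S} (hc : Injective c)
    (hrange : range c = {y | f y = x ∧ y ≠ x}) (hT : ∀ i, HangsFrom f (c i) (T i)) :
    HangsFrom f x (RootedTree.join T) := by
  choose φ hinj hroot hpar hran using hT
  have hcx : ∀ i, f (c i) = x ∧ c i ≠ x := fun i => by
    have : c i ∈ range c := mem_range_self i
    rwa [hrange] at this
  have hdesc : ∀ i v, ∃ n, f^[n] (φ i v) = c i := fun i v => by
    have : φ i v ∈ range (φ i) := mem_range_self v
    rwa [hran] at this
  have hne : ∀ i v, φ i v ≠ x := by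
    intro i v h
    obtain ⟨n, hn⟩ := hdesc i v
    rw [h] at hn
    have h2 : f^[n + 1] x = x := by rw [iterate_succ_apply', hn, (hcx i).1]
    exact (hcx i).2 (hn ▸ iterate_fixed (hf x n h2) n)
  let Φ : Option (Σ i, (T i).V) → S := fun o => o.elim x fun p => φ p.1 p.2
  refine ⟨Φ, ?_, rfl, ?_, ?_⟩
  · rintro (_ | ⟨i, v⟩) (_ | ⟨j, w⟩) h
    · rfl
    · exact absurd h.symm (hne j w)
    · exact absurd h (hne i v)
    · change φ i v = φ j w at h
      obtain ⟨n, hn⟩ := hdesc i v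
      obtain ⟨m, hm⟩ := hdesc j w
      rw [← h] at hm
      have hnm : n = m := le_antisymm
        (not_lt.1 (not_lt_of_iterate_eq_children hf (hcx j).1 (hcx i).1 (hcx i).2 hm hn))
        (not_lt.1 (not_lt_of_iterate_eq_children hf (hcx i).1 (hcx j).1 (hcx j).2 hn hm))
      subst hnm
      obtain rfl : i = j := hc (hn.symm.trans hm)
      rw [hinj i h]
  · rintro (_ | ⟨i, v⟩) hv
    · exact absurd rfl hv
    · change f (φ i v) = Φ (RootedTree.joinParent T (some ⟨i, v⟩))
      by_cases h : v = (T i).root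
      · simp only [RootedTree.joinParent, h, if_true]
        rw [hroot]
        exact (hcx i).1
      · simp only [RootedTree.joinParent, h, if_false]
        exact hpar i v h
  · ext y
    constructor
    · rintro ⟨_ | ⟨i, v⟩, rfl⟩
      · exact ⟨0, rfl⟩
      · obtain ⟨n, hn⟩ := hdesc i v
        exact ⟨n + 1, by rw [iterate_succ_apply']; exact hn ▸ (hcx i).1⟩
    · rintro ⟨n, hn⟩
      induction n with
      | zero => exact ⟨none, hn.symm⟩
      | succ n ih =>
        by_cases h : f^[n] y = x
        · exact ih h
        · rw [iterate_succ_apply'] at hn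
          have : f^[n] y ∈ range c := by rw [hrange]; exact ⟨hn, h⟩
          obtain ⟨i, hi⟩ := this
          have : y ∈ range (φ i) := by rw [hran]; exact ⟨n, hi.symm⟩
          obtain ⟨v, rfl⟩ := this
          exact ⟨some ⟨i, v⟩, rfl⟩

theorem exists_injective_range_eq {S : Type*} [Finite S] {s : Set S} {n : ℕ} (h : s.ncard = n) :
    ∃ c : Fin n → S, Injective c ∧ range c = s := by
  have e : s ≃ Fin n := Finite.equivFinOfCardEq h
  refine ⟨fun i => e.symm i, Subtype.val_injective.comp e.symm.injective, ?_⟩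
  ext y
  constructor
  · rintro ⟨i, rfl⟩
    exact (e.symm i).2
  · intro hy
    exact ⟨e ⟨y, hy⟩, by simp⟩

theorem exists_labelling {S : Type*} [Finite S] {k m : ℕ} {n : Fin k → ℕ} {s₀ : Set S}
    {s : Fin k → Set S} (hs₀ : s₀.ncard = m) (hs : ∀ j, (s j).ncard = n j)
    (hdisj₀ : ∀ j, Disjoint s₀ (s j)) (hdisj : Pairwise (Disjoint on s)) :
    ∃ c : Fin m ⊕ (Σ j : Fin k, Fin (n j)) → S, Injective c ∧ (∀ a, c (Sum.inl a) ∈ s₀) ∧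
      (∀ p, c (Sum.inr p) ∈ s p.1) ∧ range c = s₀ ∪ ⋃ j, s j := by
  obtain ⟨c₀, hc₀, hr₀⟩ := exists_injective_range_eq hs₀
  choose c hc hr using fun j => exists_injective_range_eq (hs j)
  have h₀ : ∀ a, c₀ a ∈ s₀ := fun a => hr₀ ▸ mem_range_self a
  have h : ∀ j a, c j a ∈ s j := fun j a => hr j ▸ mem_range_self a
  refine ⟨Sum.elim c₀ fun p => c p.1 p.2, ?_, h₀, fun p => h _ _, ?_⟩
  · refine hc₀.sumElim ?_ fun a p => ?_
    · rintro ⟨i, a⟩ ⟨j, b⟩ hab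
      obtain rfl : i = j := by
        by_contra hij
        exact disjoint_left.1 (hdisj hij) (h i a) ((show c i a = c j b from hab) ▸ h j b)
      exact congrArg _ (hc i hab)
    · exact fun e => disjoint_left.1 (hdisj₀ p.1) (h₀ a) (e ▸ h _ _)
  · rw [Sum.elim_range, hr₀]
    congr 1
    ext y
    simp only [mem_range, mem_iUnion, Sigma.exists, ← hr]

/-! ### Fibres of an endomorphism, sorted by height -/

section Endomorphism

variable {N : Type*} [AddCommGroup N]

/-- The number of elements of `ker f` in the image of `f^[j]`. -/
noncomputable def kerRangeCard (f : N →+ N) (j : ℕ) : ℕ :=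
  {y | f y = 0 ∧ y ∈ range f^[j]}.ncard

theorem range_iterate_succ_subset {S : Type*} (f : S → S) (j : ℕ) :
    range f^[j + 1] ⊆ range f^[j] := by
  rintro _ ⟨y, rfl⟩
  exact ⟨f y, rfl⟩

theorem range_iterate_antitone {S : Type*} (f : S → S) : Antitone fun j => range f^[j] :=
  antitone_nat_of_succ_le (range_iterate_succ_subset f)

theorem ncard_fiber_inter_range_iterate (f : N →+ N) {j : ℕ} {x : N}
    (hx : x ∈ range f^[j + 1]) :
    {y | f y = x ∧ y ∈ range f^[j]}.ncard = kerRangeCard f j := by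
  obtain ⟨z, hz⟩ := hx
  rw [iterate_succ_apply'] at hz
  -- The translating element `f^[j] z` lies in both the fibre and the image of `f^[j]`.
  have hker : {y | f y = x ∧ y ∈ range f^[j]} =
      (fun y => y + f^[j] z) '' {y | f y = 0 ∧ y ∈ range f^[j]} := by
    ext y
    constructor
    · rintro ⟨hy, w, rfl⟩
      refine ⟨f^[j] w - f^[j] z, ⟨?_, w - z, ?_⟩, by simp⟩
      · rw [map_sub, hy, hz, sub_self]
      · exact iterate_map_sub f j w z
    · rintro ⟨_, ⟨h, w, rfl⟩, rfl⟩
      refine ⟨by simp [h, hz], w + z, iterate_map_add f j w z⟩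
  rw [hker, ncard_image_of_injective _ (add_left_injective _), kerRangeCard]

variable [Finite N]

/-- The exponent `j + 2` makes the fibre meet both `range f^[j]` and `range f^[j + 1]`, so that both
coset counts apply. -/
theorem ncard_fiber_height (f : N →+ N) {j : ℕ} {x : N} (hx : x ∈ range f^[j + 2]) :
    {y | f y = x ∧ y ∈ range f^[j] ∧ y ∉ range f^[j + 1]}.ncard =
      kerRangeCard f j - kerRangeCard f (j + 1) := by
  rw [← ncard_fiber_inter_range_iterate f hx,
    ← ncard_fiber_inter_range_iterate f (range_iterate_succ_subset f _ hx), ← ncard_sdiff]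
  · congr 1
    ext y
    simp only [mem_ofPred_eq, mem_sdiff]
    tauto
  · exact fun y hy => ⟨hy.1, range_iterate_succ_subset f _ hy.2⟩

/-- Common recursion step for `levelTree` and `elementaryTree`, which differ only in the number `m`
of children of top height `k`. -/
theorem hangsFrom_join_levelTree {f : N →+ N} (hf : ∀ x n, f^[n + 1] x = x → f x = x)
    {k m : ℕ} {v : ℕ → ℕ} (hv : v = kerRangeCard f)
    (ih : ∀ j ≤ k, ∀ x, x ∈ range f^[j] → x ∉ range f^[j + 1] → HangsFrom f x (levelTree v j))
    {x : N} (hx : x ∈ range f^[k + 1])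
    (hm : {y | f y = x ∧ y ≠ x ∧ y ∈ range f^[k]}.ncard = m)
    (hmax : ∀ y, f y = x → y ≠ x → y ∉ range f^[k + 1]) :
    HangsFrom f x (RootedTree.join (ι := Fin m ⊕ (Σ j : Fin k, Fin (v j - v (j + 1))))
      (Sum.elim (fun _ => levelTree v k) (fun p => levelTree v p.1))) := by
  have hs : ∀ j : Fin k, {y | f y = x ∧ y ∈ range f^[j] ∧ y ∉ range f^[j + 1]}.ncard =
      v j - v (j + 1) := fun j => by
    rw [hv]
    exact ncard_fiber_height f (range_iterate_antitone f (by have := j.2; omega) hx)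
  obtain ⟨c, hc, hc₀, hc₁, hr⟩ := exists_labelling hm hs
    (fun j => disjoint_left.2 fun y hy hy' => hy'.2.2
      (range_iterate_antitone f (Nat.succ_le_of_lt j.2) hy.2.2)) (by
      have key : ∀ i j : Fin k, i < j →
          Disjoint {y | f y = x ∧ y ∈ range f^[i] ∧ y ∉ range f^[i + 1]}
            {y | f y = x ∧ y ∈ range f^[j] ∧ y ∉ range f^[j + 1]} := fun i j hij =>
        disjoint_left.2 fun y hy hy' => hy.2.2
          (range_iterate_antitone f (Nat.succ_le_of_lt hij) hy'.2.1)
      intro i j hij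
      rcases lt_or_gt_of_ne hij with h | h
      · exact key i j h
      · exact (key j i h).symm)
  refine HangsFrom.join hf hc ?_ ?_
  · rw [hr]
    ext y
    simp only [mem_union, mem_iUnion, mem_ofPred_eq]
    constructor
    · rintro (h | ⟨j, h⟩)
      · exact ⟨h.1, h.2.1⟩
      · refine ⟨h.1, ?_⟩
        rintro rfl
        exact h.2.2 (range_iterate_antitone f (by have := j.2; omega) hx)
    · rintro ⟨h1, h2⟩
      by_cases hk : y ∈ range f^[k]
      · exact Or.inl ⟨h1, h2, hk⟩
      · right
        clear hmax hr hc₀ hc₁ hc c hs hm ih hx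
        -- The required index is the height of `y`, which is below `k`.
        induction k with
        | zero => exact absurd ⟨y, rfl⟩ hk
        | succ k ih =>
          by_cases hk' : y ∈ range f^[k]
          · exact ⟨Fin.last k, h1, hk', hk⟩
          · obtain ⟨j, hj⟩ := ih hk'
            exact ⟨j.castSucc, hj⟩
  · rintro (a | p)
    · have := hc₀ a
      exact ih k le_rfl _ this.2.2 (hmax _ this.1 this.2.1)
    · have := hc₁ p
      exact ih p.1 p.1.2.le _ this.2.1 this.2.2

theorem hangsFrom_levelTree {f : N →+ N} (hf : ∀ x n, f^[n + 1] x = x → f x = x) (k : ℕ) :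
    ∀ x, x ∈ range f^[k] → x ∉ range f^[k + 1] →
      HangsFrom f x (levelTree (kerRangeCard f) k) := by
  induction k using Nat.strong_induction_on with
  | _ k ih =>
    intro x hx hx'
    cases k with
    | zero =>
      rw [levelTree]
      refine ⟨fun _ => x, fun _ _ _ => rfl, rfl, fun v hv => absurd rfl hv, ?_⟩
      ext y
      constructor
      · rintro ⟨_, rfl⟩
        exact ⟨0, rfl⟩
      · rintro ⟨n, hn⟩
        cases n with
        | zero => exact ⟨(), hn.symm⟩
        | succ n =>
          rw [iterate_succ_apply'] at hn
          exact absurd ⟨_, hn⟩ hx'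
    | succ k =>
      rw [levelTree]
      refine hangsFrom_join_levelTree hf rfl (fun j hj => ih j (Nat.lt_succ_of_le hj)) hx ?_ ?_
      -- The condition `y ≠ x` is automatic: a fixed `x` in `range f^[k + 1]` would also lie in
      -- `range f^[k + 2]`.
      · rw [← ncard_fiber_inter_range_iterate f hx]
        congr 1
        ext y
        refine ⟨fun h => ⟨h.1, h.2.2⟩, fun h => ⟨h.1, ?_, h.2⟩⟩
        rintro rfl
        refine hx' ?_
        obtain ⟨z, hz⟩ := hx
        exact ⟨z, by rw [iterate_succ_apply', hz, h.1]⟩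
      · rintro y hy - ⟨z, hz⟩
        exact hx' ⟨z, by rw [iterate_succ_apply', hz, hy]⟩

theorem hangsFrom_elementaryTree {f : N →+ N} {v : List ℕ}
    (hv : ∀ j, kerRangeCard f j = v.getD j 1) (hnil : ∀ x, f^[v.length] x = 0) :
    HangsFrom f 0 (elementaryTree v) := by
  have hf : ∀ x n, f^[n + 1] x = x → f x = x := by
    intro x n hn
    have hx : x = 0 := by
      -- The total `(n + 1) * v.length` is a multiple of the period, while its last `v.length` steps
      -- kill everything.
      have h1 : f^[v.length] (f^[n * v.length] x) = x := by
        rw [← iterate_add_apply, add_comm, ← Nat.succ_mul, iterate_mul]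
        exact iterate_fixed hn _
      rw [← h1, hnil]
    rw [hx, map_zero]
  have hs : (fun i => v.getD i 1) = kerRangeCard f := funext fun j => (hv j).symm
  unfold elementaryTree
  simp only
  cases h : v.length with
  | zero =>
    rw [h] at hnil
    refine ⟨fun _ => 0, fun _ _ _ => rfl, rfl, fun v hv => absurd rfl hv, ?_⟩
    ext y
    exact ⟨fun _ => ⟨0, hnil y⟩, fun _ => ⟨(), (hnil y).symm⟩⟩
  | succ e =>
    rw [h] at hnil
    refine hangsFrom_join_levelTree hf hs (fun j _ => ?_) ⟨0, hnil 0⟩ ?_ ?_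
    · rw [hs]
      exact hangsFrom_levelTree hf j
    -- The point `0` lies in its own fibre but is not its own child.
    · rw [← hv e, kerRangeCard, ← ncard_sdiff_singleton_of_mem (a := (0 : N))]
      · congr 1
        ext y
        simp only [mem_ofPred_eq, mem_sdiff, mem_singleton_iff]
        tauto
      · exact ⟨map_zero f, 0, iterate_map_zero f e⟩
    · rintro y - hy ⟨z, rfl⟩
      exact hy (hnil z)

end Endomorphism

/-! ### Iterated gcds as kernel sizes -/

theorem iterate_zsmulAddGroupHom {A : Type*} [AddCommGroup A] (t : ℤ) (j : ℕ) (a : A) :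
    (zsmulAddGroupHom t : A →+ A)^[j] a = t ^ j • a :=
  congrFun (smul_iterate t j) a

theorem range_iterate_zsmulAddGroupHom {A : Type*} [AddCommGroup A] (t : ℤ) (j : ℕ) :
    range (zsmulAddGroupHom t : A →+ A)^[j] =
      ((zsmulAddGroupHom (t ^ j) : A →+ A).range : Set A) := by
  ext a
  simp [iterate_zsmulAddGroupHom]

theorem card_ker_zsmulAddGroupHom {A : Type*} [AddCommGroup A] [Finite A] [IsAddCyclic A]
    (t : ℤ) : Nat.card (zsmulAddGroupHom t : A →+ A).ker = Int.gcd t (Nat.card A) := by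
  have h : (zsmulAddGroupHom t : A →+ A).ker = (nsmulAddMonoidHom t.natAbs : A →+ A).ker := by
    ext a
    simp [AddMonoidHom.mem_ker]
  rw [h, IsAddCyclic.card_nsmulAddMonoidHom_ker, Nat.gcd_comm]
  rfl

section Cyclic

variable {A : Type*} [AddCommGroup A]

theorem kerRangeCard_zsmul_eq_card_ker (t : ℤ) (j : ℕ) :
    kerRangeCard (zsmulAddGroupHom t : A →+ A) j =
      Nat.card (zsmulAddGroupHom t : (zsmulAddGroupHom (t ^ j) : A →+ A).range →+ _).ker := by
  rw [kerRangeCard, ← Nat.card_coe_set_eq, range_iterate_zsmulAddGroupHom]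
  refine Nat.card_congr
    { toFun := fun y => ⟨⟨y.1, y.2.2⟩, Subtype.ext y.2.1⟩
      invFun := fun y => ⟨y.1.1, congrArg Subtype.val y.2, y.1.2⟩
      left_inv := fun _ => rfl
      right_inv := fun _ => rfl }

/-- First isomorphism theorem for multiplication by `t` on `t ^ j • A`. -/
theorem card_range_zsmul_succ_mul (t : ℤ) (j : ℕ) :
    Nat.card (zsmulAddGroupHom (t ^ (j + 1)) : A →+ A).range *
      kerRangeCard (zsmulAddGroupHom t : A →+ A) j =
      Nat.card (zsmulAddGroupHom (t ^ j) : A →+ A).range := by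
  set H := (zsmulAddGroupHom (t ^ j) : A →+ A).range with hH
  have hmap : (zsmulAddGroupHom (t ^ (j + 1)) : A →+ A).range =
      (zsmulAddGroupHom t : H →+ H).range.map H.subtype := by
    ext a
    constructor
    · rintro ⟨b, rfl⟩
      exact ⟨⟨t • (t ^ j • b), H.zsmul_mem ⟨b, rfl⟩ t⟩, ⟨⟨t ^ j • b, ⟨b, rfl⟩⟩, rfl⟩,
        by simp [pow_succ', mul_smul]⟩
    · rintro ⟨_, ⟨⟨_, ⟨b, rfl⟩⟩, rfl⟩, rfl⟩
      exact ⟨b, by simp [pow_succ', mul_smul]⟩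
  rw [kerRangeCard_zsmul_eq_card_ker, hmap, AddSubgroup.card_map_of_injective
    (f := H.subtype) Subtype.val_injective, ← AddSubgroup.index_ker, mul_comm]
  exact AddSubgroup.card_mul_index _

variable [Finite A] [IsAddCyclic A]

/-- The first conjunct says that the quotient inside `iterGcdTerm` is the order of `t ^ j • A`; this
group is cyclic, so the kernel of `t` on it has order its gcd with `t`. Each conjunct feeds the next
step of the other. -/
theorem card_range_zsmul_mul_prod (t : ℤ) {n : ℕ} (hn : Nat.card A = n) (j : ℕ) :
    Nat.card (zsmulAddGroupHom (t ^ j) : A →+ A).range * ∏ i : Fin j, iterGcdTerm t n i = n ∧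
      kerRangeCard (zsmulAddGroupHom t : A →+ A) j = iterGcdTerm t n j := by
  have key : ∀ j, Nat.card (zsmulAddGroupHom (t ^ j) : A →+ A).range *
      ∏ i : Fin j, iterGcdTerm t n i = n →
      kerRangeCard (zsmulAddGroupHom t : A →+ A) j = iterGcdTerm t n j := by
    intro j h
    rw [kerRangeCard_zsmul_eq_card_ker, card_ker_zsmulAddGroupHom, iterGcdTerm]
    congr 2
    refine (Nat.div_eq_of_eq_mul_left (Nat.pos_of_ne_zero fun h0 => ?_) h.symm).symm
    rw [h0, mul_zero] at h
    exact Nat.card_pos.ne' (hn.trans h.symm)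
  induction j with
  | zero =>
    have h : Nat.card (zsmulAddGroupHom (t ^ 0) : A →+ A).range *
        ∏ i : Fin 0, iterGcdTerm t n i = n := by
      have : (zsmulAddGroupHom (t ^ 0) : A →+ A).range = ⊤ :=
        AddMonoidHom.range_eq_top.2 fun a => ⟨a, by simp⟩
      rw [this]
      simpa using hn
    exact ⟨h, key 0 h⟩
  | succ j ih =>
    have h : Nat.card (zsmulAddGroupHom (t ^ (j + 1)) : A →+ A).range *
        ∏ i : Fin (j + 1), iterGcdTerm t n i = n := by
      rw [Fin.prod_univ_castSucc]
      simp only [Fin.val_castSucc, Fin.val_last]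
      rw [mul_left_comm, ← ih.2, card_range_zsmul_succ_mul, mul_comm]
      exact ih.1
    exact ⟨h, key _ h⟩

theorem kerRangeCard_zsmul_eq_iterGcdTerm (t : ℤ) {n : ℕ} (hn : Nat.card A = n) (j : ℕ) :
    kerRangeCard (zsmulAddGroupHom t : A →+ A) j = iterGcdTerm t n j :=
  (card_range_zsmul_mul_prod t hn j).2

theorem iterGcdTerm_eq_gcd (t : ℤ) {n : ℕ} (hn : Nat.card A = n) (j : ℕ) :
    iterGcdTerm t n j = Int.gcd t (Nat.card (zsmulAddGroupHom (t ^ j) : A →+ A).range) := by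
  rw [← kerRangeCard_zsmul_eq_iterGcdTerm (A := A) t hn, kerRangeCard_zsmul_eq_card_ker,
    card_ker_zsmulAddGroupHom]

/-- A term equal to `1` means that `t` is injective on the image, which then stops shrinking. -/
theorem card_range_zsmul_eq_of_iterGcdTerm_eq_one (t : ℤ) {n : ℕ} (hn : Nat.card A = n) {D : ℕ}
    (hD : iterGcdTerm t n D = 1) (j : ℕ) :
    Nat.card (zsmulAddGroupHom (t ^ (D + j)) : A →+ A).range =
      Nat.card (zsmulAddGroupHom (t ^ D) : A →+ A).range := by
  induction j with
  | zero => rfl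
  | succ j ih =>
    have h1 : iterGcdTerm t n (D + j) = 1 := by
      rw [iterGcdTerm_eq_gcd (A := A) t hn, ih, ← iterGcdTerm_eq_gcd t hn, hD]
    have := card_range_zsmul_succ_mul (A := A) t (D + j)
    rw [kerRangeCard_zsmul_eq_iterGcdTerm t hn, h1, mul_one] at this
    rw [← ih, ← this]
    rfl

theorem iterGcdTerm_eq_one_of_le (t : ℤ) {n : ℕ} [NeZero n] {D j : ℕ}
    (hD : iterGcdTerm t n D = 1) (hj : D ≤ j) : iterGcdTerm t n j = 1 := by
  have hn : Nat.card (ZMod n) = n := Nat.card_zmod n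
  obtain ⟨j, rfl⟩ := Nat.exists_eq_add_of_le hj
  rw [iterGcdTerm_eq_gcd (A := ZMod n) t hn, card_range_zsmul_eq_of_iterGcdTerm_eq_one t hn hD,
    ← iterGcdTerm_eq_gcd t hn, hD]

theorem card_range_zsmul_eq_one {B : Type*} [AddCommGroup B] {t : ℤ} (h : ∀ b : B, t • b = 0) :
    Nat.card (zsmulAddGroupHom t : B →+ B).range = 1 := by
  have : (zsmulAddGroupHom t : B →+ B).range = ⊥ := by
    rw [eq_bot_iff]
    rintro _ ⟨b, rfl⟩
    exact h b
  rw [this]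
  exact AddSubgroup.card_bot

theorem pow_zsmul_eq_zero_of_iterGcdTerm_eq_one {t : ℤ} {n : ℕ} (hn : Nat.card A = n) {D M : ℕ}
    (hM : ∀ a : A, t ^ M • a = 0) (hD : iterGcdTerm t n D = 1) (a : A) : t ^ D • a = 0 := by
  have h1 : Nat.card (zsmulAddGroupHom (t ^ D) : A →+ A).range = 1 := by
    rw [← card_range_zsmul_eq_of_iterGcdTerm_eq_one t hn hD M]
    exact card_range_zsmul_eq_one fun b => by rw [pow_add, mul_smul, hM, smul_zero]
  have h2 := AddSubgroup.card_eq_one.1 h1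
  exact AddSubgroup.mem_bot.1 (h2 ▸ ⟨a, rfl⟩)

end Cyclic

theorem iterGcd_spec {t : ℤ} {n M : ℕ} [NeZero n] (hM : ∀ a : ZMod n, t ^ M • a = 0) :
    iterGcdTerm t n (iterGcd t n).length = 1 ∧
      ∀ j, (iterGcd t n).getD j 1 = iterGcdTerm t n j := by
  have hn : Nat.card (ZMod n) = n := Nat.card_zmod n
  have h0 : iterGcdTerm t n 0 = Int.gcd t n := by rw [iterGcdTerm]; simp
  unfold iterGcd
  split_ifs with h
  · rw [h] at h0
    refine ⟨iterGcdTerm_eq_one_of_le t h0 (Nat.zero_le _), fun j => ?_⟩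
    rw [iterGcdTerm_eq_one_of_le t h0 (Nat.zero_le j)]
    cases j <;> simp
  · have hne : {D : ℕ | 0 < D ∧ iterGcdTerm t n D = 1}.Nonempty := by
      -- Nilpotency keeps the infimum from being the junk value `sInf ∅ = 0`; `M + 1` replaces `M`
      -- to ensure positivity.
      refine ⟨M + 1, Nat.succ_pos _, ?_⟩
      rw [iterGcdTerm_eq_gcd (A := ZMod n) t hn, card_range_zsmul_eq_one
        fun b => by rw [pow_succ', mul_smul, hM, smul_zero]]
      simp
    obtain ⟨-, hD⟩ := Nat.sInf_mem hne
    refine ⟨by simpa using hD, fun j => ?_⟩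
    set D := sInf {D : ℕ | 0 < D ∧ iterGcdTerm t n D = 1}
    rcases lt_or_ge j D with hj | hj
    · rw [List.getD_eq_getElem _ _ (by simpa using hj)]
      simp
    · rw [List.getD_eq_default _ _ (by simpa using hj), iterGcdTerm_eq_one_of_le t hD hj]

theorem getD_seqProd {k : ℕ} (u : Fin k → List ℕ) (j : ℕ) :
    (seqProd u).getD j 1 = ∏ i, (u i).getD j 1 := by
  unfold seqProd
  rcases lt_or_ge j (Finset.univ.sup fun i => (u i).length) with hj | hj
  · rw [List.getD_eq_getElem _ _ (by simpa using hj)]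
    simp
  · rw [List.getD_eq_default _ _ (by simpa using hj)]
    refine (Finset.prod_eq_one fun i _ => List.getD_eq_default _ _ ?_).symm
    exact (Finset.le_sup (f := fun i => (u i).length) (Finset.mem_univ i)).trans hj

theorem kerRangeCard_zsmul_pi {k : ℕ} {A : Fin k → Type*} [∀ i, AddCommGroup (A i)] (t : ℤ)
    (j : ℕ) : kerRangeCard (zsmulAddGroupHom t : (∀ i, A i) →+ _) j =
      ∏ i, kerRangeCard (zsmulAddGroupHom t : A i →+ A i) j := by
  simp only [kerRangeCard, ← Nat.card_coe_set_eq, ← Nat.card_pi, range_iterate_zsmulAddGroupHom]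
  refine Nat.card_congr
    { toFun := fun y i => ⟨y.1 i, congrFun y.2.1 i, ?_⟩
      invFun := fun y => ⟨fun i => (y i).1, funext fun i => (y i).2.1, ?_⟩
      left_inv := fun _ => rfl
      right_inv := fun _ => rfl }
  · obtain ⟨z, hz⟩ := y.2.2
    exact ⟨z i, congrFun hz i⟩
  · choose z hz using fun i => (y i).2.2
    exact ⟨z, funext hz⟩

theorem hangsFrom_pi_zmod {k : ℕ} {t : ℤ} {ν : Fin k → ℕ} [∀ i, NeZero (ν i)] {M : ℕ}
    (hM : ∀ i, (ν i : ℤ) ∣ t ^ M) :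
    HangsFrom (fun x : ∀ i, ZMod (ν i) => t • x) 0
      (elementaryTree (seqProd fun i => iterGcd t (ν i))) := by
  have hM' : ∀ i, ∀ a : ZMod (ν i), t ^ M • a = 0 := fun i a => by
    rw [zsmul_eq_mul, (ZMod.intCast_zmod_eq_zero_iff_dvd _ _).2 (hM i), zero_mul]
  refine hangsFrom_elementaryTree (N := ∀ i, ZMod (ν i)) (f := zsmulAddGroupHom t)
    (fun j => ?_) fun x => ?_
  · rw [kerRangeCard_zsmul_pi, getD_seqProd]
    refine Finset.prod_congr rfl fun i _ => ?_
    rw [(iterGcd_spec (hM' i)).2, kerRangeCard_zsmul_eq_iterGcdTerm t (Nat.card_zmod _)]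
  · rw [iterate_zsmulAddGroupHom]
    funext i
    refine pow_zsmul_eq_zero_of_iterGcdTerm_eq_one (Nat.card_zmod _) (hM' i)
      (iterGcdTerm_eq_one_of_le t (iterGcd_spec (hM' i)).1 ?_) _
    simpa [seqProd] using
      Finset.le_sup (f := fun i => (iterGcd t (ν i)).length) (Finset.mem_univ i)

/-! ### Cycle decomposition of the bijective part -/

/-- A map of a finite set all of whose points have minimal period `m > 0` is a disjoint union of
`m`-cycles. -/
theorem exists_equiv_of_minimalPeriod_eq {S : Type*} [Finite S] {f : S → S} {m : ℕ}
    (hf : ∀ x, minimalPeriod f x = m ∧ 0 < m) :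
    m ∣ Nat.card S ∧ ∃ E : S ≃ Fin (Nat.card S / m) × ZMod m,
      ∀ x, E (f x) = ((E x).1, (E x).2 + 1) := by
  rcases isEmpty_or_nonempty S with hS | ⟨⟨x₀⟩⟩
  · have : IsEmpty (Fin (Nat.card S / m) × ZMod m) := by
      simp only [Nat.card_of_isEmpty, Nat.zero_div]
      infer_instance
    exact ⟨by simp, Equiv.equivOfIsEmpty _ _, fun x => (hS.false x).elim⟩
  have hm : 0 < m := (hf x₀).2
  have : NeZero m := ⟨hm.ne'⟩
  have hmod : ∀ n x, f^[n % m] x = f^[n] x := fun n x => by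
    rw [← (hf x).1, iterate_mod_minimalPeriod_eq]
  let R : Setoid S :=
    { r := fun x y => ∃ n, f^[n] x = y
      iseqv :=
        { refl := fun x => ⟨0, rfl⟩
          symm := by
            rintro x _ ⟨n, rfl⟩
            refine ⟨m * n - n, ?_⟩
            rw [← iterate_add_apply, Nat.sub_add_cancel (Nat.le_mul_of_pos_left n hm), ← hmod]
            simp
          trans := by
            rintro x _ _ ⟨n, rfl⟩ ⟨l, rfl⟩
            exact ⟨l + n, iterate_add_apply f l n x⟩ } }
  -- A point is encoded by its orbit and its offset from the chosen representative.
  let ψ : Quotient R × ZMod m → S := fun p => f^[p.2.val] p.1.out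
  have hψ : ∀ q i, ψ (q, i + 1) = f (ψ (q, i)) := fun q i => by
    change f^[(i + 1).val] q.out = f (f^[i.val] q.out)
    rw [← iterate_succ_apply' f, ZMod.val_add, hmod, ZMod.val_one_eq_one_mod,
      ← hmod (i.val + 1 % m), Nat.add_mod_mod, hmod]
  have hbij : Bijective ψ := by
    constructor
    · rintro ⟨q, i⟩ ⟨q', j⟩ h
      change f^[i.val] q.out = f^[j.val] q'.out at h
      have hq : ∀ (q : Quotient R) n, (⟦f^[n] q.out⟧ : Quotient R) = q := fun q n => by
        rw [← Quotient.out_eq q, Quotient.out_eq q]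
        exact Eq.trans (Quotient.sound (Setoid.symm ⟨n, rfl⟩)) (Quotient.out_eq q)
      obtain rfl : q = q' := by rw [← hq q i.val, h, hq]
      have : i.val = j.val :=
        iterate_injOn_Iio_minimalPeriod (f := f) (x := q.out)
          (by rw [(hf _).1]; exact i.val_lt) (by rw [(hf _).1]; exact j.val_lt) h
      rw [ZMod.val_injective m this]
    · intro x
      obtain ⟨n, hn⟩ : ∃ n, f^[n] (⟦x⟧ : Quotient R).out = x := Quotient.mk_out x
      refine ⟨(⟦x⟧, n), ?_⟩
      change f^[(n : ZMod m).val] _ = x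
      rw [ZMod.val_natCast, hmod, hn]
  let e := Equiv.ofBijective ψ hbij
  have hcard : Nat.card S = Nat.card (Quotient R) * m := by
    rw [← Nat.card_congr e, Nat.card_prod, Nat.card_zmod]
  have hQ : Nat.card (Quotient R) = Nat.card S / m := by
    rw [hcard, Nat.mul_div_cancel _ hm]
  refine ⟨⟨_, hcard.trans (mul_comm _ _)⟩,
    e.symm.trans ((Finite.equivFinOfCardEq hQ).prodCongr (Equiv.refl _)), fun x => ?_⟩
  obtain ⟨⟨q, i⟩, rfl⟩ := e.surjective x
  have : f (e (q, i)) = e (q, i + 1) := (hψ q i).symm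
  rw [this]
  simp

/-- A map of a finite set, with an invariant labelling that determines the minimal periods, is a
disjoint union of cycles. -/
theorem exists_equiv_sigma_cycles {S D : Type*} [Finite S] {f : S → S} (l : S → D)
    (hl : ∀ x, l (f x) = l x) (m : D → ℕ)
    (hm : ∀ x, minimalPeriod f x = m (l x) ∧ 0 < m (l x)) (n : D → ℕ)
    (hn : ∀ d, Nat.card {x // l x = d} = n d) :
    (∀ d, m d ∣ n d) ∧ ∃ E : S ≃ Σ d, Fin (n d / m d) × ZMod (m d),
      ∀ x, E (f x) = ⟨(E x).1, (E x).2.1, (E x).2.2 + 1⟩ := by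
  let g : ∀ d, {x // l x = d} → {x // l x = d} := fun d x => ⟨f x.1, (hl x.1).trans x.2⟩
  have hg : ∀ d j x, ((g d)^[j] x).1 = f^[j] x.1 := fun d j x => by
    have : Semiconj Subtype.val (g d) f := fun _ => rfl
    exact this.iterate_right j x
  have hper : ∀ d (x : {x // l x = d}), minimalPeriod (g d) x = m d ∧ 0 < m d := by
    rintro d ⟨x, rfl⟩
    refine ⟨?_, (hm x).2⟩
    rw [← (hm x).1]
    refine minimalPeriod_eq_minimalPeriod_iff.2 fun j => ?_
    rw [IsPeriodicPt, IsPeriodicPt, IsFixedPt, IsFixedPt, Subtype.ext_iff, hg]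
  obtain rfl : (fun d => Nat.card {x // l x = d}) = n := funext hn
  choose hdvd E hE using fun d => exists_equiv_of_minimalPeriod_eq (hper d)
  let Ψ := (Equiv.sigmaFiberEquiv l).symm.trans (Equiv.sigmaCongrRight E)
  have hΨ : ∀ d x, Ψ (Equiv.sigmaFiberEquiv l ⟨d, x⟩) = ⟨d, E d x⟩ := by
    rintro d ⟨x, rfl⟩
    rfl
  refine ⟨hdvd, Ψ, fun x => ?_⟩
  obtain ⟨⟨d, x⟩, rfl⟩ := (Equiv.sigmaFiberEquiv l).surjective x
  have : f (Equiv.sigmaFiberEquiv l ⟨d, x⟩) = Equiv.sigmaFiberEquiv l ⟨d, g d x⟩ := rfl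
  rw [this, hΨ, hΨ, hE]

/-- `t ^ n` fixes `p i` exactly when `addOrderOf (p i)` divides `t ^ n - 1`, that is, when `t ^ n =
1` modulo that order. -/
theorem minimalPeriod_zsmul_pi {k : ℕ} {A : Fin k → Type*} [∀ i, AddCommGroup (A i)] (t : ℤ)
    (p : ∀ i, A i) :
    minimalPeriod (fun x : ∀ i, A i => t • x) p = ordLcm (fun i => addOrderOf (p i)) t := by
  refine eq_of_forall_dvd fun n => ?_
  rw [← isPeriodicPt_iff_minimalPeriod_dvd, IsPeriodicPt, IsFixedPt, smul_iterate, ordLcm,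
    Finset.lcm_dvd_iff, funext_iff]
  simp only [Finset.mem_univ, true_imp_iff]
  refine forall_congr' fun i => ?_
  rw [orderOf_dvd_iff_pow_eq_one]
  refine (sub_eq_zero.symm.trans ?_).trans sub_eq_zero
  have h1 : (t ^ n • p) i - p i = (t ^ n - 1) • p i := by
    rw [sub_smul, one_smul]
    rfl
  have h2 : ((t : ZMod (addOrderOf (p i))) ^ n - 1) = ((t ^ n - 1 : ℤ) : ZMod _) := by
    push_cast
    rfl
  rw [h1, h2, ZMod.intCast_zmod_eq_zero_iff_dvd, addOrderOf_dvd_iff_zsmul_eq_zero]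

theorem card_addOrderOf_pi_zmod {k : ℕ} {ω d : Fin k → ℕ} [∀ i, NeZero (ω i)]
    (hd : ∀ i, d i ∣ ω i) :
    Nat.card {p : ∀ i, ZMod (ω i) // ∀ i, addOrderOf (p i) = d i} = totientProd d := by
  rw [Nat.card_congr (Equiv.subtypePiEquivPi (p := fun i (x : ZMod (ω i)) => addOrderOf x = d i)),
    Nat.card_pi, totientProd]
  refine Finset.prod_congr rfl fun i _ => ?_
  rw [Nat.card_eq_fintype_card, Fintype.card_subtype]
  exact IsAddCyclic.card_addOrderOf_eq_totient (by rw [ZMod.card]; exact hd i)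

theorem zsmul_bijective_pi_zmod {k : ℕ} {t : ℤ} {ω : Fin k → ℕ} (h : ∀ i, IsCoprime t (ω i)) :
    Bijective fun x : ∀ i, ZMod (ω i) => t • x := by
  choose a b hab using h
  have hinv : ∀ i (x : ZMod (ω i)), a i • t • x = x := fun i x => by
    have := congrArg (fun z : ℤ => (z : ZMod (ω i))) (hab i)
    push_cast at this
    rw [ZMod.natCast_self, mul_zero, add_zero] at this
    rw [smul_smul, zsmul_eq_mul]
    push_cast
    rw [this, one_mul]
  refine bijective_iff_has_inverse.2 ⟨fun x i => a i • x i, fun x => funext fun i => hinv i (x i),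
    fun x => funext fun i => ?_⟩
  exact (smul_comm _ _ _).trans (hinv i (x i))

theorem mem_periodicPts_of_injective {S : Type*} [Finite S] {f : S → S} (hf : Injective f)
    (x : S) : x ∈ periodicPts f := by
  let σ := Equiv.ofBijective f (Finite.injective_iff_bijective.1 hf)
  refine ⟨orderOf σ, orderOf_pos σ, ?_⟩
  have : f^[orderOf σ] = ⇑(σ ^ orderOf σ) := (Equiv.Perm.coe_pow σ _).symm
  rw [IsPeriodicPt, IsFixedPt, this, pow_orderOf_eq_one]
  rfl

theorem exists_equiv_pi_zmod_cycles {k : ℕ} {t : ℤ} {ω : Fin k → ℕ} [∀ i, NeZero (ω i)]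
    (h : ∀ i, IsCoprime t (ω i)) :
    (∀ d : Fin k → ℕ, (∀ i, d i ∣ ω i) → ordLcm d t ∣ totientProd d) ∧
    ∃ E : (∀ i, ZMod (ω i)) ≃ Σ d : {d : Fin k → ℕ // ∀ i, d i ∣ ω i},
        Fin (totientProd d.1 / ordLcm d.1 t) × ZMod (ordLcm d.1 t),
      ∀ x, E (t • x) = ⟨(E x).1, (E x).2.1, (E x).2.2 + 1⟩ := by
  have hbij := zsmul_bijective_pi_zmod h
  have hord : ∀ (x : ∀ i, ZMod (ω i)) i, addOrderOf (x i) ∣ ω i := fun x i =>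
    (addOrderOf_dvd_natCard (x i)).trans (Nat.card_zmod _).dvd
  have key := exists_equiv_sigma_cycles (f := fun x : ∀ i, ZMod (ω i) => t • x)
    (D := {d : Fin k → ℕ // ∀ i, d i ∣ ω i}) (fun x => ⟨fun i => addOrderOf (x i), hord x⟩)
    (fun x => Subtype.ext <| funext fun i => ?_) (fun d => ordLcm d.1 t)
    (fun x => ⟨minimalPeriod_zsmul_pi t x, ?_⟩) (fun d => totientProd d.1) (fun d => ?_)
  · exact ⟨fun d hd => key.1 ⟨d, hd⟩, key.2⟩
  · have hinj : Injective fun y : ZMod (ω i) => t • y := fun y z hyz => by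
      have := @hbij.1 (Function.update 0 i y) (Function.update 0 i z) (funext fun j => by
        by_cases hj : j = i
        · subst hj
          simpa using hyz
        · simp [hj])
      simpa using congrFun this i
    exact addOrderOf_injective (zsmulAddGroupHom t : ZMod (ω i) →+ _) hinj (x i)
  · rw [← minimalPeriod_zsmul_pi t x]
    exact minimalPeriod_pos_of_mem_periodicPts (mem_periodicPts_of_injective hbij.1 x)
  · rw [← card_addOrderOf_pi_zmod d.2]
    refine Nat.card_congr (Equiv.subtypeEquivRight fun x => ?_)
    rw [Subtype.ext_iff, funext_iff]

/-! ### Gluing trees onto cycles -/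

/-- A map `N → N` whose graph is the tree `T`, times a permutation `σ`, is conjugate to the map
given by the tree `T` hung on every point of the permutation. -/
theorem HangsFrom.exists_equiv_prod {N P : Type*} {f : N → N} {o : N} {T : RootedTree}
    (hT : HangsFrom f o T) (ho : f o = o) (hnil : ∀ x, ∃ n, f^[n] x = o) (σ : Equiv.Perm P) :
    ∃ E : N × P ≃ P × T.V, ∀ x p,
      ((E (x, p)).2 = T.root → E (f x, σ p) = (σ (E (x, p)).1, T.root)) ∧
      ((E (x, p)).2 ≠ T.root → E (f x, σ p) = ((E (x, p)).1, T.parent (E (x, p)).2)) := by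
  classical
  obtain ⟨φ, hinj, hroot, hpar, hran⟩ := hT
  have hsurj : Surjective φ := fun x => by
    have : x ∈ range φ := by rw [hran]; exact hnil x
    exact this
  let e := Equiv.ofBijective φ ⟨hinj, hsurj⟩
  have heo : e.symm o = T.root := e.symm_apply_eq.2 hroot.symm
  have hes : ∀ x, x ≠ o → e.symm (f x) = T.parent (e.symm x) := fun x hx => by
    rw [e.symm_apply_eq]
    have h := hpar (e.symm x) fun h => hx (by rw [← hroot, ← h]; exact (e.apply_symm_apply x).symm)
    rw [show φ (e.symm x) = x from e.apply_symm_apply x] at h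
    exact h
  let depth : N → ℕ := fun x => Nat.find (hnil x)
  have hdepth : ∀ x, x ≠ o → depth x = depth (f x) + 1 := fun x hx => by
    refine (Nat.find_eq_iff _).2 ⟨?_, fun n hn h => ?_⟩
    · rw [iterate_succ_apply]
      exact Nat.find_spec (hnil (f x))
    · cases n with
      | zero => exact hx h
      | succ n => exact Nat.find_min (hnil (f x)) (Nat.lt_of_succ_lt_succ hn) h
  have hdepth₀ : depth o = 0 := (Nat.find_eq_zero _).2 rfl
  -- Twisting by `σ ^ depth x` compensates for `σ`: off the root a step lowers the depth by one
  -- while `σ` acts once, so the `P`-coordinate changes only at the root.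
  let E : N × P ≃ P × T.V :=
    { toFun := fun x => ((σ ^ depth x.1) x.2, e.symm x.1)
      invFun := fun y => (e y.2, (σ ^ depth (e y.2))⁻¹ y.1)
      left_inv := fun x => by simp
      right_inv := fun y => by simp }
  refine ⟨E, fun x p => ⟨fun h => ?_, fun h => ?_⟩⟩
  · have hx : x = o := e.symm.injective (h.trans heo.symm)
    subst hx
    simp only [E, Equiv.coe_fn_mk, ho, heo, hdepth₀, pow_zero, Equiv.Perm.one_apply]
  · have hx : x ≠ o := by
      rintro rfl
      exact h heo
    simp only [E, Equiv.coe_fn_mk, hes x hx, hdepth x hx, pow_succ, Equiv.Perm.mul_apply]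

theorem disjointUnion_copies_cyc_adj_iff {D : Type*} {n m : D → ℕ} {T : RootedTree}
    {d : D} {c : Fin (n d)} {i : ZMod (m d)} {v : T.V}
    (b : Σ d, Σ _ : Fin (n d), ZMod (m d) × T.V) :
    (disjointUnion fun d => copies (n d) (Cyc (m d) T)).Adj ⟨d, c, i, v⟩ b ↔
      (v = T.root ∧ b = ⟨d, c, i + 1, T.root⟩) ∨ (v ≠ T.root ∧ b = ⟨d, c, i, T.parent v⟩) := by
  constructor
  · rintro ⟨d', x, y, hx, rfl, c', z, w, hz, rfl, h⟩
    cases hx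
    cases hz
    obtain ⟨j, w⟩ := w
    rcases h with ⟨h1, h2, h3⟩ | ⟨h1, h2, h3⟩
    · right
      simp only at h1 h2 h3
      subst h1 h3
      exact ⟨h2, rfl⟩
    · left
      simp only at h1 h2 h3
      subst h1 h2 h3
      exact ⟨rfl, rfl⟩
  · rintro (⟨rfl, rfl⟩ | ⟨h, rfl⟩)
    · exact ⟨d, _, _, rfl, rfl, c, _, _, rfl, rfl, Or.inr ⟨rfl, rfl, rfl⟩⟩
    · exact ⟨d, _, _, rfl, rfl, c, _, _, rfl, rfl, Or.inl ⟨rfl, h, rfl⟩⟩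

/-! ### Splitting off the part coprime to `t` -/

section Arithmetic

variable {t : ℤ} {r ν ω : ℕ}

/-- Otherwise `p * ω` would be a larger divisor of `r` coprime to `t`. -/
theorem prime_dvd_of_isGreatest (hr : 0 < r)
    (hω : IsGreatest {d : ℕ | d ∣ r ∧ IsCoprime t (d : ℤ)} ω) (hν : r = ν * ω) {p : ℕ}
    (hp : p.Prime) (hpν : p ∣ ν) : (p : ℤ) ∣ t := by
  by_contra h
  have hcop : IsCoprime t ((p * ω : ℕ) : ℤ) := by
    rw [Nat.cast_mul]
    exact ((Nat.prime_iff_prime_int.1 hp).coprime_iff_not_dvd.2 h).symm.mul_right hω.1.2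
  have hle : p * ω ≤ ω := hω.2 ⟨hν ▸ Nat.mul_dvd_mul_right hpν ω, hcop⟩
  have hpos : 0 < ω := Nat.pos_of_dvd_of_pos hω.1.1 hr
  have := hp.two_le
  nlinarith

theorem coprime_of_isGreatest (hr : 0 < r)
    (hω : IsGreatest {d : ℕ | d ∣ r ∧ IsCoprime t (d : ℤ)} ω) (hν : r = ν * ω) :
    ν.Coprime ω := by
  refine Nat.coprime_of_dvd fun p hp hpν hpω => ?_
  exact (Nat.prime_iff_prime_int.1 hp).not_isUnit
    (hω.1.2.isUnit_of_dvd' (prime_dvd_of_isGreatest hr hω hν hp hpν)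
      (Int.natCast_dvd_natCast.2 hpω))

theorem dvd_pow_of_isGreatest (hr : 0 < r)
    (hω : IsGreatest {d : ℕ | d ∣ r ∧ IsCoprime t (d : ℤ)} ω) (hν : r = ν * ω) :
    (ν : ℤ) ∣ t ^ ν := by
  have hν0 : ν ≠ 0 := by
    rintro rfl
    omega
  -- The prime factor criterion needs `t ≠ 0`, since `0` has an empty set of `primeFactors`.
  rcases eq_or_ne t 0 with rfl | ht
  · rw [zero_pow hν0]
    exact dvd_zero _
  · rw [Int.natCast_dvd, Int.natAbs_pow, Nat.dvd_pow_self_iff hν0 (Int.natAbs_ne_zero.2 ht)]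
    intro p hp
    have hp' := Nat.prime_of_mem_primeFactors hp
    exact Nat.mem_primeFactors.2 ⟨hp', Int.natCast_dvd.1
      (prime_dvd_of_isGreatest hr hω hν hp' (Nat.dvd_of_mem_primeFactors hp)),
      Int.natAbs_ne_zero.2 ht⟩

end Arithmetic

theorem exists_equiv_zmod_prod {C : Type*} [Group C] [IsCyclic C] {ν ω : ℕ}
    (hC : Nat.card C = ν * ω) (h : ν.Coprime ω) (t : ℤ) :
    ∃ E : C ≃ ZMod ν × ZMod ω, ∀ c, E (c ^ t) = t • E c := by
  let e : C ≃* Multiplicative (ZMod (ν * ω)) :=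
    mulEquivOfCyclicCardEq (hC.trans (Nat.card_zmod _).symm)
  let e' : ZMod (ν * ω) ≃+ ZMod ν × ZMod ω := (ZMod.chineseRemainder h).toAddEquiv
  refine ⟨e.toEquiv.trans (Multiplicative.toAdd.trans e'.toEquiv), fun c => ?_⟩
  change e' (Multiplicative.toAdd (e (c ^ t))) = t • e' (Multiplicative.toAdd (e c))
  rw [map_zpow, toAdd_zpow, map_zsmul]

theorem exists_equiv_pi_zmod_prod {G : Type*} [Group G] (t : ℤ) {k : ℕ} {C : Fin k → Type*}
    [∀ i, Group (C i)] [∀ i, IsCyclic (C i)] {ν ω : Fin k → ℕ}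
    (hC : ∀ i, Nat.card (C i) = ν i * ω i) (h : ∀ i, (ν i).Coprime (ω i))
    (e : G ≃* ∀ i, C i) :
    ∃ E : G ≃ (∀ i, ZMod (ν i)) × (∀ i, ZMod (ω i)), ∀ g, E (g ^ t) = t • E g := by
  choose E hE using fun i => exists_equiv_zmod_prod (hC i) (h i) t
  refine ⟨e.toEquiv.trans ((Equiv.piCongrRight E).trans
    (Equiv.arrowProdEquivProdArrow _ _ _)), fun g => ?_⟩
  ext i
  · change (E i (e (g ^ t) i)).1 = t • (E i (e g i)).1
    rw [map_zpow, Pi.pow_apply, hE]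
    rfl
  · change (E i (e (g ^ t) i)).2 = t • (E i (e g i)).2
    rw [map_zpow, Pi.pow_apply, hE]
    rfl

/-- The periodic points correspond to `{0} × P`: a nilpotent map has no other periodic point than
`0`, and an injective map of a finite set has only periodic points. -/
theorem ncard_periodicPts_of_conj_zsmul {G N P : Type*} [AddCommGroup N] [AddCommGroup P]
    [Finite P] {f : G → G} {t : ℤ} (E : G ≃ N × P) (hE : ∀ g, E (f g) = t • E g) {M : ℕ}
    (hN : ∀ x : N, t ^ M • x = 0) (hP : Injective fun p : P => t • p) :
    (periodicPts f).ncard = Nat.card P := by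
  have hiter : ∀ n g, E (f^[n] g) = t ^ n • E g := fun n g => by
    have : Semiconj E f (fun x => t • x) := hE
    exact (this.iterate_right n g).trans (congrFun (smul_iterate t n) (E g))
  have hset : ∀ g, g ∈ periodicPts f ↔ (E g).1 = 0 := by
    intro g
    constructor
    · rintro ⟨n, hn, hg⟩
      -- A multiple of the period that is at least `M`, so that `t ^ M` kills the first coordinate.
      have h1 : f^[n * (M + 1)] g = g := hg.mul_const (M + 1)
      have h2 := congrArg Prod.fst (hiter (n * (M + 1)) g)
      obtain ⟨l, hl⟩ : ∃ l, n * (M + 1) = l + M :=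
        ⟨n * (M + 1) - M, by have := Nat.le_mul_of_pos_left (M + 1) hn; omega⟩
      rw [h1, hl, pow_add, mul_smul, Prod.smul_fst, Prod.smul_fst, hN, smul_zero] at h2
      exact h2
    · intro h
      obtain ⟨n, hn, hp⟩ := mem_periodicPts_of_injective hP (E g).2
      rw [IsPeriodicPt, IsFixedPt, smul_iterate] at hp
      refine ⟨n, hn, E.injective ?_⟩
      rw [hiter]
      exact Prod.ext (by rw [Prod.smul_fst, h, smul_zero]) hp
  rw [← Nat.card_coe_set_eq]
  exact Nat.card_congr
    { toFun := fun g => (E g.1).2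
      invFun := fun p => ⟨E.symm (0, p), (hset _).2 (by simp)⟩
      left_inv := fun g => Subtype.ext <| E.symm_apply_eq.2 <|
        Prod.ext ((hset _).1 g.2).symm rfl
      right_inv := fun p => by simp }

end PowerMap

/-! ### Assembly -/

open PowerMap in
theorem mainTheorem3 {G : Type*} [CommGroup G] (t : ℤ) {k : ℕ}
    (C : Fin k → Type*) [∀ i, Group (C i)] [∀ i, IsCyclic (C i)]
    (r ν ω : Fin k → ℕ) (hr : ∀ i, 0 < r i) (hC : ∀ i, Nat.card (C i) = r i)
    (e : G ≃* ((i : Fin k) → C i))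
    (hω : ∀ i, IsGreatest {d : ℕ | d ∣ r i ∧ IsCoprime t (d : ℤ)} (ω i))
    (hν : ∀ i, r i = ν i * ω i) :
    (Function.periodicPts (fun g : G => g ^ t)).ncard = ∏ i, ω i ∧
    (∀ d : Fin k → ℕ, (∀ i, d i ∣ ω i) → ordLcm d t ∣ totientProd d) ∧
    DigraphIso
      (functionalGraph (fun g : G => g ^ t))
      (disjointUnion fun d : {d : Fin k → ℕ // ∀ i, d i ∣ ω i} =>
        copies (totientProd d.1 / ordLcm d.1 t)
          (Cyc (ordLcm d.1 t) (elementaryTree (seqProd fun i => iterGcd t (ν i))))) := by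
  have hcop : ∀ i, IsCoprime t (ω i) := fun i => (hω i).1.2
  have hpos : ∀ i, 0 < ν i ∧ 0 < ω i := fun i =>
    CanonicallyOrderedAdd.mul_pos.1 (hν i ▸ hr i)
  have _ : ∀ i, NeZero (ν i) := fun i => ⟨(hpos i).1.ne'⟩
  have _ : ∀ i, NeZero (ω i) := fun i => ⟨(hpos i).2.ne'⟩
  -- The sum of the `ν j` serves as one nilpotency exponent for all factors.
  have hM : ∀ i, (ν i : ℤ) ∣ t ^ ∑ j, ν j := fun i =>
    (dvd_pow_of_isGreatest (hr i) (hω i) (hν i)).trans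
      (pow_dvd_pow t (Finset.single_le_sum (f := ν) (fun _ _ => Nat.zero_le _)
        (Finset.mem_univ i)))
  have hN : ∀ x : ∀ i, ZMod (ν i), (t ^ ∑ j, ν j) • x = 0 := fun x => funext fun i => by
    rw [Pi.smul_apply, zsmul_eq_mul, (ZMod.intCast_zmod_eq_zero_iff_dvd _ _).2 (hM i), zero_mul,
      Pi.zero_apply]
  have hbij := zsmul_bijective_pi_zmod hcop
  obtain ⟨E, hE⟩ := exists_equiv_pi_zmod_prod t (fun i => (hC i).trans (hν i))
    (fun i => coprime_of_isGreatest (hr i) (hω i) (hν i)) e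
  obtain ⟨hdvd, Ecyc, hEcyc⟩ := exists_equiv_pi_zmod_cycles hcop
  refine ⟨?_, hdvd, ?_⟩
  · rw [ncard_periodicPts_of_conj_zsmul E hE hN hbij.1, Nat.card_pi]
    exact Finset.prod_congr rfl fun i _ => Nat.card_zmod _
  · have hT := hangsFrom_pi_zmod hM
    generalize elementaryTree (seqProd fun i => iterGcd t (ν i)) = T at hT ⊢
    obtain ⟨F, hF⟩ := hT.exists_equiv_prod (smul_zero t)
      (fun x => ⟨_, (congrFun (smul_iterate t _) x).trans (hN x)⟩) (Equiv.ofBijective _ hbij)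
    let R : (Σ d : {d : Fin k → ℕ // ∀ i, d i ∣ ω i},
        Fin (totientProd d.1 / ordLcm d.1 t) × ZMod (ordLcm d.1 t)) × T.V ≃
        Σ d : {d : Fin k → ℕ // ∀ i, d i ∣ ω i},
          Σ _ : Fin (totientProd d.1 / ordLcm d.1 t), ZMod (ordLcm d.1 t) × T.V :=
      { toFun := fun x => ⟨x.1.1, x.1.2.1, x.1.2.2, x.2⟩
        invFun := fun x => (⟨x.1, x.2.1, x.2.2.1⟩, x.2.2.2)
        left_inv := fun _ => rfl
        right_inv := fun _ => rfl }
    let Φ := (E.trans F).trans ((Ecyc.prodCongr (Equiv.refl T.V)).trans R)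
    refine ⟨⟨Φ, fun {a b} => ?_⟩⟩
    change _ ↔ a ^ t = b
    rw [← Φ.apply_eq_iff_eq (x := a ^ t)]
    have hΦ : ∀ g, Φ g = ⟨(Ecyc (F (E g)).1).1, (Ecyc (F (E g)).1).2.1,
      (Ecyc (F (E g)).1).2.2, (F (E g)).2⟩ := fun _ => rfl
    have hstep : E (a ^ t) = (t • (E a).1, Equiv.ofBijective _ hbij (E a).2) := hE a
    rw [hΦ a, disjointUnion_copies_cyc_adj_iff, hΦ (a ^ t), hstep]
    -- At a root the edge advances along the cycle; elsewhere it goes to the parent in the same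
    -- tree.
    by_cases h : (F (E a)).2 = T.root
    · have hroot : F (t • (E a).1, Equiv.ofBijective _ hbij (E a).2) =
        (t • (F (E a)).1, T.root) := (hF (E a).1 (E a).2).1 h
      rw [hroot, hEcyc]
      simp only [h, not_true, ne_eq, true_and, false_and, or_false]
      exact eq_comm
    · rw [(hF (E a).1 (E a).2).2 h]
      simp only [Prod.mk.eta, h, ne_eq, not_false_eq_true, true_and, false_and, false_or]
      exact eq_comm
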